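/- Let $X$ be an integer-valued random variable with $\mathbf P(X\ge -1)=1$, $\mathbf E|X|<\infty$, $\mathbf E X\le 0$ and $\mathbf P(X=0)<1$. Let $(S_t)_{t\ge 0}$ be the random walk whose steps are i.i.d. copies of $X$, and write $\mathbf P_z$ for the probability measure under which $S_0=z$. Let $\sigma=\inf\{t\ge 0: S_t\le 0\}$. Set $\tau_0=0$ and, for $i\ge 0$, $$L_i=\max\{k\in\mathbb N: S_{\tau_i}\ge 2^{k}\},\qquad \tau_{i+1}=\inf\{t\ge\tau_i: S_t\notin[2^{L_i-1},2^{L_i+2})\},$$ where $\mathbb N=\{0,1,2,\dots\}$, $\inf\emptyset=\infty$, and $L_i=-\infty$ if $S_{\tau_i}\le 0$ (then $\tau_{i+1}=\tau_i$). For $0\le t<\sigma$ the scale at time $t$ is $\Lambda(t)=L_j$ with $j=\max\{i:\tau_i\le t\}$. For an integer $\ell\ge 0$ put $$N_\ell=\#\{0\le t<\sigma:\Lambda(t)=\ell\},\qquad H_\ell=\sum_{0\le t<\sigma,\ \Lambda(t)=\ell}\frac1{S_t},$$ and $$n_\ell=\min\Big\{t\in\mathbb N:\ \sup_{x\in\mathbb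 Z\cap[2^{\ell-1},2^{\ell+2})}\mathbf P_x\big(\tau\ge t\big)\le \tfrac12\Big\},\qquad \tau=\inf\{s\ge 0:S_s\notin[2^{\ell-1},2^{\ell+2})\}.$$ Then for every integer $\ell\ge 0$, every real $b>0$ and every $z\in\mathbb Z$, $$\mathbf P_z\Big(H_\ell\ge b\cdot\frac{n_\ell}{2^{\ell-1}}\Big)\ \le\ \mathbf P_z\big(N_\ell\ge b\,n_\ell\big)\ \le\ \min\Big(1,\frac{\max(z,0)}{2^{\ell-1}}\Big)\cdot 2^{1-b/18}.$$ -/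

import Mathlib

open MeasureTheory ProbabilityTheory
open scoped ENNReal

namespace ScaleWalk

/-- The integers in `[2^(ℓ-1), 2^(ℓ+2))` for `ℓ ≥ 0`; for `ℓ = -∞` this is `[0, 0) = ∅`. -/
def scaleInterval : WithBot ℕ → Set ℤ
  | ⊥ => ∅
  | (ℓ : ℕ) => {x : ℤ | (2 : ℝ) ^ ((ℓ : ℤ) - 1) ≤ (x : ℝ) ∧ (x : ℝ) < (2 : ℝ) ^ ((ℓ : ℤ) + 2)}

/-- `max {ℓ : x ≥ 2^ℓ}` for an integer `x`; this is `-∞` when `x ≤ 0`. -/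
def level (x : ℤ) : WithBot ℕ :=
  if 0 < x then ((Nat.log 2 x.toNat : ℕ) : WithBot ℕ) else ⊥

theorem mem_scaleInterval_coe (ℓ : ℕ) (x : ℤ) :
    x ∈ scaleInterval (ℓ : WithBot ℕ) ↔
      (2 : ℝ) ^ ((ℓ : ℤ) - 1) ≤ (x : ℝ) ∧ (x : ℝ) < (2 : ℝ) ^ ((ℓ : ℤ) + 2) := Iff.rfl

theorem coe_le_level_iff (ℓ : ℕ) (x : ℤ) : (ℓ : WithBot ℕ) ≤ level x ↔ (2 : ℤ) ^ ℓ ≤ x := by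
  unfold level
  split_ifs with hx
  · obtain ⟨n, rfl⟩ := Int.eq_ofNat_of_zero_le hx.le
    have hn : n ≠ 0 := by rintro rfl; simp at hx
    rw [Nat.cast_le, Int.toNat_natCast, Nat.le_log_iff_pow_le (by norm_num) hn]
    exact_mod_cast Iff.rfl
  · have : (0 : ℤ) < 2 ^ ℓ := by positivity
    constructor
    · intro h
      exact absurd h (by simp)
    · intro h
      omega

/-- The first time `σ` at which the path is non-positive (`∞` if there is none). -/
noncomputable def hitTime (s : ℕ → ℤ) : ℕ∞ :=
  ⨅ (t : ℕ) (_ : s t ≤ 0), (t : ℕ∞)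

/-- The first time at which the path is outside `[2^(ℓ-1), 2^(ℓ+2))` (`∞` if there is none). -/
noncomputable def exitTime (ℓ : ℕ) (s : ℕ → ℤ) : ℕ∞ :=
  ⨅ (t : ℕ) (_ : s t ∉ scaleInterval (ℓ : WithBot ℕ)), (t : ℕ∞)

/-- The level of the path at a time `τ ∈ ℕ ∪ {∞}`. The value at `τ = ∞` plays no role. -/
def levelAt (s : ℕ → ℤ) : ℕ∞ → WithBot ℕ
  | ⊤ => ⊥
  | (t : ℕ) => level (s t)

/-- The times `τ_i` of the changes of scale: `τ_0 = 0`, and `τ_{i+1}` is the first `t ≥ τ_i`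
with `s t ∉ [2^(L_i - 1), 2^(L_i + 2))`, where `L_i` is the level of the path at time `τ_i`. -/
noncomputable def changeTime (s : ℕ → ℤ) : ℕ → ℕ∞
  | 0 => 0
  | i + 1 => ⨅ (t : ℕ) (_ : changeTime s i ≤ (t : ℕ∞) ∧
      s t ∉ scaleInterval (levelAt s (changeTime s i))), (t : ℕ∞)

/-- The successive scales `L_i`. -/
noncomputable def scaleSeq (s : ℕ → ℤ) (i : ℕ) : WithBot ℕ := levelAt s (changeTime s i)

/-- The current scale at time `t` is `ℓ`, i.e. `L_j = ℓ` for `j = max {i : τ_i ≤ t}`. -/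
def AtScale (s : ℕ → ℤ) (ℓ t : ℕ) : Prop :=
  ∃ j : ℕ, IsGreatest {i : ℕ | changeTime s i ≤ (t : ℕ∞)} j ∧ scaleSeq s j = (ℓ : WithBot ℕ)

/-- The times `0 ≤ t < σ` at which the current scale is `ℓ`. -/
def timesAtScale (s : ℕ → ℤ) (ℓ : ℕ) : Set ℕ :=
  {t : ℕ | (t : ℕ∞) < hitTime s ∧ AtScale s ℓ t}

/-- `N_ℓ`, the total time spent at scale `ℓ` before time `σ`. -/
noncomputable def occupation (s : ℕ → ℤ) (ℓ : ℕ) : ℕ∞ := (timesAtScale s ℓ).encard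

/-- `H_ℓ`, the sum of `1 / s t` over the times `t < σ` spent at scale `ℓ`
(all the terms have `s t > 0`). -/
noncomputable def harmonicOccupation (s : ℕ → ℤ) (ℓ : ℕ) : ℝ≥0∞ :=
  ∑' t : timesAtScale s ℓ, 1 / ENNReal.ofReal (s t : ℝ)

/-- The random walk started from `z` with steps `X 0, X 1, …`. -/
def walk {Ω : Type*} (X : ℕ → Ω → ℤ) (z : ℤ) (ω : Ω) (t : ℕ) : ℤ :=
  z + ∑ i ∈ Finset.range t, X i ω

/-- `n_ℓ`, the least `t ∈ ℕ` such that, from every starting point `x` in `[2^(ℓ-1), 2^(ℓ+2))`,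
the exit time from this interval is at least `t` with probability at most `1/2`. -/
noncomputable def halfTime {Ω : Type*} [MeasurableSpace Ω] (P : Measure Ω) (X : ℕ → Ω → ℤ)
    (ℓ : ℕ) : ℕ∞ :=
  ⨅ (t : ℕ) (_ : (⨆ x ∈ scaleInterval (ℓ : WithBot ℕ),
      P {ω | (t : ℕ∞) ≤ exitTime ℓ (walk X x ω)}) ≤ 1 / 2), (t : ℕ∞)

end ScaleWalk

namespace ScaleWalk

/-! The pair (position, current scale) is a Markov chain, so the claim reduces to one-step
inequalities for functions on its states. Put `n` for $n_\ell$. Surviving a block of `n` steps in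
the interval has probability at most 1/2, so the expected exit time is at most `2n`
(`expectedExit_le`). The height $r = x^+/2^\ell$ is a supermartingale while the walk is positive, so
scale `ℓ` is ever reached with probability at most $\min(1, r)$ (`lintegral_reachBound_le`).
Together these give the superharmonic function `potential`, at most `9n`, which pays 1 for each time
at scale `ℓ`. A Markov inequality (`mul_countProb_le`) then shows that `18n` times at scale `ℓ`
occur with probability at most 1/2 from any state. Restarting the chain gives the factor `2⁻¹ ^ ⌊b /
18⌋₊` (`countProb_mul_le_pow`), and stopping at the first visit to scale `ℓ` adds the factor
`reachBound` (`countProb_le_reachBound_mul`). The comparison of $H_\ell$ with $N_\ell$ is pathwise: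
positions at scale `ℓ` are at least $2^{\ell-1}$. -/

/-! ### Markov chains driven by i.i.d. increments. -/

/-- The deterministic recursion driven by the increments `x 0, x 1, …`. -/
def chain {S : Type*} (step : S → ℤ → S) (s : S) (x : ℕ → ℤ) : ℕ → S
  | 0 => s
  | t + 1 => step (chain step s x t) (x t)

/-- The transition operator of the Markov chain with update rule `step` and increments
distributed as `Y`. -/
noncomputable def transOp {Ω S : Type*} [MeasurableSpace Ω] (P : Measure Ω) (Y : Ω → ℤ)
    (step : S → ℤ → S) (f : S → ℝ≥0∞) (s : S) : ℝ≥0∞ :=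
  ∫⁻ ω, f (step s (Y ω)) ∂P

/-- The state at time `t` depends only on the increments before `t`, hence is independent of `X t`;
Fubini on the product law integrates out the last step. -/
theorem lintegral_chain {Ω S : Type*} [MeasurableSpace Ω] [Countable S] (P : Measure Ω)
    [IsProbabilityMeasure P] (X : ℕ → Ω → ℤ) (hmeas : ∀ i, Measurable (X i))
    (hindep : iIndepFun X P) (hident : ∀ i, IdentDistrib (X i) (X 0) P P)
    (step : S → ℤ → S) (s : S) (t : ℕ) (f : S → ℝ≥0∞) :
    ∫⁻ ω, f (chain step s (fun i => X i ω) t) ∂P = (transOp P (X 0) step)^[t] f s := by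
  let _ : MeasurableSpace S := ⊤
  have hpast : ∀ t : ℕ, Measurable[⨆ i ∈ Set.Iio t, MeasurableSpace.comap (X i) inferInstance]
      (fun ω => chain step s (fun i => X i ω) t) := by
    intro t
    induction t with
    | zero => exact measurable_const
    | succ t ih =>
      have h1 : Measurable[⨆ i ∈ Set.Iio (t + 1), MeasurableSpace.comap (X i) inferInstance]
          (fun ω => chain step s (fun i => X i ω) t) :=
        ih.mono (biSup_mono fun i hi => Nat.lt_succ_of_lt hi) le_rfl
      have h2 : Measurable[⨆ i ∈ Set.Iio (t + 1), MeasurableSpace.comap (X i) inferInstance]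
          (X t) :=
        (comap_measurable (X t)).mono
          (le_iSup₂_of_le (f := fun i (_ : i ∈ Set.Iio (t + 1)) =>
            MeasurableSpace.comap (X i) inferInstance) t (Nat.lt_succ_self t) le_rfl) le_rfl
      have h3 : Measurable (Function.uncurry step) := measurable_of_countable _
      exact h3.comp (h1.prodMk h2)
  induction t generalizing f with
  | zero => simp [chain]
  | succ t ih =>
    rw [Function.iterate_succ_apply, ← ih]
    have hm : Measurable (fun ω => chain step s (fun i => X i ω) t) :=
      (hpast t).mono (iSup₂_le fun i _ => (hmeas i).comap_le) le_rfl
    have hind : IndepFun (fun ω => chain step s (fun i => X i ω) t) (X t) P := by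
      have h := indep_iSup_of_disjoint (fun i => (hmeas i).comap_le) hindep.iIndep
        (S := Set.Iio t) (T := {t}) (by simp)
      rw [IndepFun_iff_Indep]
      refine indep_of_indep_of_le_left (indep_of_indep_of_le_right h ?_) (hpast t).comap_le
      simp
    have hmap := (indepFun_iff_map_prod_eq_prod_map_map hm.aemeasurable
      (hmeas t).aemeasurable).1 hind
    have hf : Measurable (fun p : S × ℤ => f (step p.1 p.2)) := measurable_of_countable _
    have : IsProbabilityMeasure (P.map (X t)) :=
      Measure.isProbabilityMeasure_map (hmeas t).aemeasurable
    calc ∫⁻ ω, f (chain step s (fun i => X i ω) (t + 1)) ∂P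
        = ∫⁻ p, f (step p.1 p.2)
            ∂(P.map fun ω => (chain step s (fun i => X i ω) t, X t ω)) := by
          rw [lintegral_map hf (hm.prodMk (hmeas t))]; rfl
      _ = ∫⁻ u, ∫⁻ y, f (step u y) ∂(P.map (X t))
            ∂(P.map fun ω => chain step s (fun i => X i ω) t) := by
          rw [hmap, lintegral_prod _ hf.aemeasurable]
      _ = ∫⁻ u, transOp P (X 0) step f u
            ∂(P.map fun ω => chain step s (fun i => X i ω) t) := by
          refine lintegral_congr fun u => ?_
          rw [(hident t).map_eq, lintegral_map (measurable_of_countable _) (hmeas 0)]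
          rfl
      _ = _ := lintegral_map (measurable_of_countable _) hm

theorem measurableSet_chain {Ω S : Type*} [MeasurableSpace Ω] [Countable S] (X : ℕ → Ω → ℤ)
    (hmeas : ∀ i, Measurable (X i)) (step : S → ℤ → S) (s : S) (t : ℕ) (A : Set S) :
    MeasurableSet {ω | chain step s (fun i => X i ω) t ∈ A} := by
  let _ : MeasurableSpace S := ⊤
  have h : Measurable (fun ω => chain step s (fun i => X i ω) t) := by
    induction t with
    | zero => exact measurable_const
    | succ t ih =>
      exact (measurable_of_countable (Function.uncurry step)).comp (ih.prodMk (hmeas t))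
  exact h (MeasurableSpace.measurableSet_top (s := A))

/-! ### The scale as the state of an automaton reading the path. -/

theorem mem_scaleInterval_iff (ℓ : ℕ) (x : ℤ) :
    x ∈ scaleInterval (ℓ : WithBot ℕ) ↔ (2 : ℤ) ^ ℓ ≤ 2 * x ∧ x < 4 * 2 ^ ℓ := by
  rw [mem_scaleInterval_coe, zpow_sub₀ two_ne_zero, zpow_add₀ two_ne_zero, zpow_natCast,
    zpow_one, div_le_iff₀ two_pos]
  norm_num
  constructor
  · rintro ⟨h1, h2⟩
    constructor
    · have : (2 : ℝ) ^ ℓ ≤ 2 * x := by linarith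
      exact_mod_cast this
    · have : (x : ℝ) < 4 * 2 ^ ℓ := by linarith
      exact_mod_cast this
  · rintro ⟨h1, h2⟩
    constructor
    · have : (2 : ℝ) ^ ℓ ≤ 2 * x := by exact_mod_cast h1
      linarith
    · have : (x : ℝ) < 4 * 2 ^ ℓ := by exact_mod_cast h2
      linarith

theorem pos_of_mem_scaleInterval {L : WithBot ℕ} {x : ℤ} (h : x ∈ scaleInterval L) : 0 < x := by
  induction L with
  | bot => exact h.elim
  | coe ℓ =>
    have := ((mem_scaleInterval_iff ℓ x).1 h).1
    have : (0 : ℤ) < 2 ^ ℓ := by positivity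
    omega

theorem level_eq_coe_iff (ℓ : ℕ) (x : ℤ) :
    level x = (ℓ : WithBot ℕ) ↔ (2 : ℤ) ^ ℓ ≤ x ∧ x < 2 * 2 ^ ℓ := by
  have h1 := coe_le_level_iff ℓ x
  have h2 := coe_le_level_iff (ℓ + 1) x
  rw [pow_succ, mul_comm] at h2
  rw [← h1, ← not_le, ← h2, not_le]
  induction h : level x with
  | bot => simp
  | coe k =>
    simp only [WithBot.coe_inj, Nat.cast_withBot, WithBot.coe_le_coe, WithBot.coe_lt_coe]
    omega

theorem level_eq_bot_iff (x : ℤ) : level x = ⊥ ↔ x ≤ 0 := by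
  unfold level
  split_ifs with h
  · simp; exact h
  · simpa using h

theorem mem_scaleInterval_level {x : ℤ} (h : 0 < x) : x ∈ scaleInterval (level x) := by
  induction hL : level x with
  | bot => rw [level_eq_bot_iff] at hL; omega
  | coe k =>
    have := (level_eq_coe_iff k x).1 hL
    exact (mem_scaleInterval_iff k x).2 ⟨by omega, by omega⟩

open Classical in
/-- The scale after a move to `y` from a position with current scale `L`. -/
noncomputable def nextScale (L : WithBot ℕ) (y : ℤ) : WithBot ℕ :=
  -- The second branch makes `⊥` absorbing, even if the path becomes positive again.
  if y ∈ scaleInterval L then L else if L = ⊥ then ⊥ else level y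

/-- The current scale along a path, `⊥` from the first non-positive time on. -/
noncomputable def scalePath (s : ℕ → ℤ) : ℕ → WithBot ℕ
  | 0 => level (s 0)
  | t + 1 => nextScale (scalePath s t) (s (t + 1))

/-- The position `x` is compatible with the current scale `L`. -/
def Compatible (x : ℤ) (L : WithBot ℕ) : Prop := L = ⊥ ∨ x ∈ scaleInterval L

theorem compatible_level (x : ℤ) : Compatible x (level x) := by
  rcases le_or_gt x 0 with h | h
  · exact Or.inl ((level_eq_bot_iff x).2 h)
  · exact Or.inr (mem_scaleInterval_level h)

theorem compatible_nextScale (L : WithBot ℕ) (y : ℤ) : Compatible y (nextScale L y) := by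
  unfold nextScale
  split_ifs with h1 h2
  · exact Or.inr h1
  · exact Or.inl rfl
  · exact compatible_level y

theorem nextScale_bot (y : ℤ) : nextScale ⊥ y = ⊥ := by
  simp [nextScale]

/-- A scale is always entered through its own dyadic block $[2^\ell, 2^{\ell+1})$, well inside the
interval; the reach bound and the constant 7 in `potential` rest on this. -/
theorem level_of_nextScale_eq {L : WithBot ℕ} {y : ℤ} {ℓ : ℕ} (hL : L ≠ ℓ)
    (h : nextScale L y = ℓ) : level y = ℓ := by
  unfold nextScale at h
  split_ifs at h with h1 h2
  · exact absurd h hL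
  · exact absurd h (by simp)
  · exact h

theorem compatible_scalePath (s : ℕ → ℤ) (t : ℕ) : Compatible (s t) (scalePath s t) := by
  cases t with
  | zero => exact compatible_level _
  | succ t => exact compatible_nextScale _ _

theorem iInf_coe_eq_coe {p : ℕ → Prop} {t : ℕ} (h : ⨅ (u : ℕ) (_ : p u), (u : ℕ∞) = t) :
    p t ∧ ∀ u, p u → t ≤ u := by
  classical
  have hle : ∀ u, p u → t ≤ u := fun u hu => by
    have : (⨅ (u : ℕ) (_ : p u), (u : ℕ∞)) ≤ u := iInf₂_le u hu
    rw [h] at this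
    exact_mod_cast this
  refine ⟨?_, hle⟩
  by_contra ht
  have : ((t + 1 : ℕ) : ℕ∞) ≤ ⨅ (u : ℕ) (_ : p u), (u : ℕ∞) := by
    refine le_iInf₂ fun u hu => ?_
    have h1 := hle u hu
    have h2 : u ≠ t := fun e => ht (e ▸ hu)
    exact_mod_cast (by omega : t + 1 ≤ u)
  rw [h] at this
  have : t + 1 ≤ t := by exact_mod_cast this
  omega

theorem scalePath_eq_of_mem (s : ℕ → ℤ) {a t : ℕ} (hat : a ≤ t)
    (h : ∀ u, a < u → u ≤ t → s u ∈ scaleInterval (scalePath s a)) :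
    scalePath s t = scalePath s a := by
  induction t, hat using Nat.le_induction with
  | base => rfl
  | succ t hat ih =>
    have h1 := ih fun u hu hut => h u hu (by omega)
    rw [scalePath, h1, nextScale, if_pos (h (t + 1) (by omega) le_rfl)]

theorem scalePath_changeTime (s : ℕ → ℤ) (i a : ℕ) (h : changeTime s i = a) :
    scalePath s a = level (s a) := by
  induction i generalizing a with
  | zero =>
    have : a = 0 := by
      have h' : (0 : ℕ∞) = a := h
      exact_mod_cast h'.symm
    subst this
    rfl
  | succ i ih =>
    obtain ⟨⟨h1, h2⟩, h3⟩ := iInf_coe_eq_coe h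
    obtain ⟨c, hc⟩ : ∃ c : ℕ, changeTime s i = c :=
      ENat.ne_top_iff_exists.1 (ne_top_of_le_ne_top (ENat.natCast_ne_top a) h1) |>.imp fun _ h => h.symm
    rw [hc] at h1 h2 h3
    have ihc := ih c hc
    change s a ∉ scaleInterval (level (s c)) at h2
    have h3' : ∀ u, c ≤ u → s u ∉ scaleInterval (level (s c)) → a ≤ u :=
      fun u hu hu' => h3 u ⟨by exact_mod_cast hu, hu'⟩
    have hca : c ≤ a := by exact_mod_cast h1
    -- At a non-positive position the interval is empty, so the next change time is the same time.
    rcases le_or_gt (s c) 0 with hneg | hpos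
    · have hb := (level_eq_bot_iff (s c)).2 hneg
      have : a ≤ c := h3' c le_rfl (by rw [hb]; exact fun h => h)
      obtain rfl : a = c := le_antisymm this hca
      exact ihc
    · have hne : a ≠ c := by
        rintro rfl
        exact h2 (mem_scaleInterval_level hpos)
      obtain ⟨d, rfl⟩ : ∃ d, a = d + 1 := ⟨a - 1, by omega⟩
      have hd : scalePath s d = scalePath s c := by
        refine scalePath_eq_of_mem s (by omega) fun u hu hud => ?_
        rw [ihc]
        by_contra hcon
        have := h3' u hu.le hcon
        omega
      have hb : level (s c) ≠ ⊥ := by rw [Ne, level_eq_bot_iff]; omega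
      rw [scalePath, hd, ihc, nextScale, if_neg h2, if_neg hb]

/-- By maximality of `j` the path has not left its interval since the change time `c`: leaving at
some `u ≤ t` would give a further change time up to `t`. -/
theorem scalePath_eq_of_atScale (s : ℕ → ℤ) (ℓ t : ℕ) (h : AtScale s ℓ t) :
    scalePath s t = ℓ := by
  obtain ⟨j, ⟨hj, hmax⟩, hL⟩ := h
  obtain ⟨c, hc⟩ : ∃ c : ℕ, changeTime s j = c :=
    ENat.ne_top_iff_exists.1 (ne_top_of_le_ne_top (ENat.natCast_ne_top t) hj) |>.imp fun _ h => h.symm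
  have hL' : level (s c) = ℓ := by rw [← hL, scaleSeq, hc]; rfl
  have hcp := scalePath_changeTime s j c hc
  have hct : c ≤ t := by
    have : changeTime s j ≤ t := hj
    rw [hc] at this
    exact_mod_cast this
  rw [scalePath_eq_of_mem s hct, hcp, hL']
  intro u hu hut
  rw [hcp]
  by_contra hcon
  have h1 : changeTime s (j + 1) ≤ u := by
    refine iInf₂_le u ⟨?_, ?_⟩
    · rw [hc]; exact_mod_cast hu.le
    · rw [hc]; exact hcon
  have h2 : j + 1 ≤ j := hmax (h1.trans (by exact_mod_cast hut))
  omega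

/-- The times at which the current scale is `ℓ` lie among those where the automaton shows `ℓ`. -/
theorem timesAtScale_subset (s : ℕ → ℤ) (ℓ : ℕ) :
    timesAtScale s ℓ ⊆ {t | scalePath s t = ℓ} :=
  fun t ht => scalePath_eq_of_atScale s ℓ t ht.2

theorem harmonicOccupation_le (s : ℕ → ℤ) (ℓ : ℕ) :
    harmonicOccupation s ℓ ≤ ((occupation s ℓ : ℕ∞) : ℝ≥0∞) / (2 : ℝ≥0∞) ^ ((ℓ : ℤ) - 1) := by
  have h : ∀ t : timesAtScale s ℓ,
      1 / ENNReal.ofReal (s t : ℝ) ≤ ((2 : ℝ≥0∞) ^ ((ℓ : ℤ) - 1))⁻¹ := by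
    rintro ⟨t, ht⟩
    have hscale := timesAtScale_subset s ℓ ht
    have hmem : s t ∈ scaleInterval (ℓ : WithBot ℕ) := by
      rcases compatible_scalePath s t with h | h
      · rw [hscale] at h; exact absurd h (by simp)
      · rwa [hscale] at h
    have h1 := ((mem_scaleInterval_coe ℓ (s t)).1 hmem).1
    rw [one_div, ENNReal.inv_le_inv]
    have h2 := ENNReal.ofReal_le_ofReal h1
    refine le_of_eq_of_le ?_ h2
    rw [← ENNReal.ofReal_ofNat, ENNReal.ofReal, ENNReal.ofReal, Real.toNNReal_zpow two_pos.le,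
      ENNReal.coe_zpow (by simp)]
  refine (ENNReal.tsum_le_tsum h).trans ?_
  rw [ENNReal.tsum_const, div_eq_mul_inv]
  rfl

/-! ### Survival in one interval and the expected exit time. -/

section Survival

variable {Ω : Type*} [MeasurableSpace Ω] (P : Measure Ω) (Y : Ω → ℤ)

open Classical in
/-- The probability that the walk started from `x` is in `[2^(ℓ-1), 2^(ℓ+2))` at all times
before `t`, as the solution of its one-step recursion. -/
noncomputable def survival (ℓ : ℕ) : ℕ → ℤ → ℝ≥0∞
  | 0, _ => 1
  | t + 1, x => if x ∈ scaleInterval (ℓ : WithBot ℕ) then ∫⁻ ω, survival ℓ t (x + Y ω) ∂P else 0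

theorem survival_of_notMem (ℓ t : ℕ) {x : ℤ} (hx : x ∉ scaleInterval (ℓ : WithBot ℕ)) :
    survival P Y ℓ (t + 1) x = 0 := by
  simp [survival, hx]

theorem survival_of_mem (ℓ t : ℕ) {x : ℤ} (hx : x ∈ scaleInterval (ℓ : WithBot ℕ)) :
    survival P Y ℓ (t + 1) x = ∫⁻ ω, survival P Y ℓ t (x + Y ω) ∂P := by
  simp [survival, hx]

theorem survival_succ_le_lintegral (ℓ t : ℕ) (x : ℤ) :
    survival P Y ℓ (t + 1) x ≤ ∫⁻ ω, survival P Y ℓ t (x + Y ω) ∂P := by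
  by_cases hx : x ∈ scaleInterval (ℓ : WithBot ℕ)
  · rw [survival_of_mem P Y ℓ t hx]
  · rw [survival_of_notMem P Y ℓ t hx]; exact zero_le

/-- The Markov property at time `a`: wherever the walk then is, it survives `b` more steps with
probability at most `c`. -/
theorem survival_add_le {ℓ b : ℕ} {c : ℝ≥0∞} (hY : Measurable Y)
    (hc : ∀ y, survival P Y ℓ b y ≤ c) (a : ℕ) (x : ℤ) :
    survival P Y ℓ (a + b) x ≤ survival P Y ℓ a x * c := by
  induction a generalizing x with
  | zero => simpa [survival] using hc x
  | succ a ih =>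
    rw [Nat.add_right_comm]
    by_cases hx : x ∈ scaleInterval (ℓ : WithBot ℕ)
    · rw [survival_of_mem P Y ℓ _ hx, survival_of_mem P Y ℓ _ hx, ← lintegral_mul_const c
        (f := fun ω => survival P Y ℓ a (x + Y ω))
        ((measurable_of_countable fun y => survival P Y ℓ a (x + y)).comp hY)]
      exact lintegral_mono fun ω => ih _
    · rw [survival_of_notMem P Y ℓ _ hx]; exact zero_le

theorem survival_mul_le_pow {ℓ n : ℕ} {c : ℝ≥0∞} (hY : Measurable Y)
    (hc : ∀ y, survival P Y ℓ n y ≤ c) (k : ℕ) (x : ℤ) :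
    survival P Y ℓ (k * n) x ≤ c ^ k := by
  induction k generalizing x with
  | zero => simp [survival]
  | succ k ih =>
    rw [Nat.succ_mul, pow_succ]
    exact (survival_add_le P Y hY hc (k * n) x).trans (mul_le_mul' (ih x) le_rfl)

/-- The expected exit time from the interval `[2^(ℓ-1), 2^(ℓ+2))`. -/
noncomputable def expectedExit (ℓ : ℕ) (x : ℤ) : ℝ≥0∞ := ∑' t, survival P Y ℓ (t + 1) x

theorem expectedExit_of_notMem (ℓ : ℕ) {x : ℤ} (hx : x ∉ scaleInterval (ℓ : WithBot ℕ)) :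
    expectedExit P Y ℓ x = 0 := by
  simp [expectedExit, survival_of_notMem P Y ℓ _ hx]

variable [IsProbabilityMeasure P]

theorem survival_le_one (ℓ t : ℕ) (x : ℤ) : survival P Y ℓ t x ≤ 1 := by
  induction t generalizing x with
  | zero => exact le_rfl
  | succ t ih =>
    refine (survival_succ_le_lintegral P Y ℓ t x).trans ?_
    exact (lintegral_mono fun ω => ih _).trans (by simp)

theorem survival_add_le_left (ℓ a b : ℕ) (hY : Measurable Y) (x : ℤ) :
    survival P Y ℓ (a + b) x ≤ survival P Y ℓ a x := by
  simpa using survival_add_le P Y hY (survival_le_one P Y ℓ b) a x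

theorem expectedExit_of_mem (ℓ : ℕ) (hY : Measurable Y) {x : ℤ}
    (hx : x ∈ scaleInterval (ℓ : WithBot ℕ)) :
    expectedExit P Y ℓ x = 1 + ∫⁻ ω, expectedExit P Y ℓ (x + Y ω) ∂P := by
  unfold expectedExit
  rw [tsum_eq_zero_add' ENNReal.summable, lintegral_tsum
    (f := fun t ω => survival P Y ℓ (t + 1) (x + Y ω)) fun t => ((measurable_of_countable fun y => survival P Y ℓ (t + 1) (x + y)).comp hY).aemeasurable]
  congr 1
  · rw [survival_of_mem P Y ℓ 0 hx]
    simp [survival]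
  · exact tsum_congr fun t => survival_of_mem P Y ℓ (t + 1) hx

/-- Cut time into blocks of length `n`. Each term in block `k` is at most $2^{-k}$, and the
geometric series sums to 2. -/
theorem expectedExit_le {ℓ n : ℕ} (hY : Measurable Y) (hn : 0 < n)
    (hc : ∀ y, survival P Y ℓ n y ≤ 2⁻¹) (x : ℤ) : expectedExit P Y ℓ x ≤ n * 2 := by
  have hblock : ∀ k : ℕ, ∑ t ∈ Finset.range (k * n), survival P Y ℓ (t + 1) x
      ≤ n * ∑ j ∈ Finset.range k, (2⁻¹ : ℝ≥0∞) ^ j := by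
    intro k
    induction k with
    | zero => simp
    | succ k ih =>
      rw [Nat.succ_mul, Finset.sum_range_add, Finset.sum_range_succ, mul_add]
      refine add_le_add ih ?_
      calc ∑ i ∈ Finset.range n, survival P Y ℓ (k * n + i + 1) x
          ≤ ∑ i ∈ Finset.range n, (2⁻¹ : ℝ≥0∞) ^ k := Finset.sum_le_sum fun i _ => by
            rw [add_assoc]
            exact (survival_add_le_left P Y ℓ _ _ hY x).trans (survival_mul_le_pow P Y hY hc k x)
        _ = _ := by simp
  refine ENNReal.tsum_le_of_sum_range_le fun m => ?_
  calc ∑ t ∈ Finset.range m, survival P Y ℓ (t + 1) x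
      ≤ ∑ t ∈ Finset.range (m * n), survival P Y ℓ (t + 1) x :=
        Finset.sum_le_sum_of_subset (Finset.range_mono (Nat.le_mul_of_pos_right m hn))
    _ ≤ n * ∑ j ∈ Finset.range m, (2⁻¹ : ℝ≥0∞) ^ j := hblock m
    _ ≤ n * 2 := by
        gcongr
        refine (ENNReal.sum_le_tsum _).trans ?_
        rw [ENNReal.tsum_geometric, ENNReal.one_sub_inv_two, inv_inv]

/-- If downward steps have positive probability, the walk leaves the interval eventually. -/
theorem exists_survival_le_half (ℓ : ℕ) (hY : Measurable Y) (hpos : P {ω | Y ω = -1} ≠ 0) :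
    ∃ t, ∀ x, survival P Y ℓ t x ≤ 2⁻¹ := by
  -- From height at most `j`, a run of `j` down-steps leads out of the interval; the induction turns
  -- its positive probability into a bound below 1.
  have hstep : ∀ j : ℕ, ∃ c < 1, ∀ x : ℤ, x ≤ j → survival P Y ℓ (j + 1) x ≤ c := by
    intro j
    induction j with
    | zero =>
      refine ⟨0, zero_lt_one, fun x hx => ?_⟩
      rw [survival_of_notMem]
      intro h
      have := pos_of_mem_scaleInterval h
      push_cast at hx
      omega
    | succ j ih =>
      obtain ⟨c, hc, h⟩ := ih
      have hA : MeasurableSet {ω | Y ω = -1} := hY (measurableSet_singleton (-1 : ℤ))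
      refine ⟨c * P {ω | Y ω = -1} + P {ω | Y ω = -1}ᶜ, ?_, fun x hx => ?_⟩
      · have h1 : P {ω | Y ω = -1} + P {ω | Y ω = -1}ᶜ = 1 := by
          rw [measure_add_measure_compl hA, measure_univ]
        rw [← h1]
        refine ENNReal.add_lt_add_right (measure_ne_top _ _) ?_
        conv_rhs => rw [← one_mul (P {ω | Y ω = -1})]
        exact ENNReal.mul_lt_mul_left hpos (measure_ne_top _ _) hc
      · refine (survival_succ_le_lintegral P Y ℓ _ x).trans ?_
        rw [← lintegral_add_compl _ hA]
        refine add_le_add ?_ ?_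
        · rw [← setLIntegral_const]
          refine setLIntegral_mono' hA fun ω hω => h _ ?_
          have : Y ω = -1 := hω
          push_cast at hx
          omega
        · refine (setLIntegral_mono' hA.compl fun ω _ =>
            survival_le_one P Y ℓ (j + 1) (x + Y ω)).trans ?_
          simp
  obtain ⟨c, hc, h⟩ := hstep (4 * 2 ^ ℓ)
  have h' : ∀ x, survival P Y ℓ (4 * 2 ^ ℓ + 1) x ≤ c := by
    intro x
    by_cases hx : x ∈ scaleInterval (ℓ : WithBot ℕ)
    · refine h x ?_
      push_cast
      exact ((mem_scaleInterval_iff ℓ x).1 hx).2.le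
    · rw [survival_of_notMem P Y ℓ _ hx]; exact zero_le
  have hlim := ENNReal.tendsto_pow_atTop_nhds_zero_of_lt_one hc
  obtain ⟨k, hk⟩ := (hlim.eventually_le_const (show (0 : ℝ≥0∞) < 2⁻¹ by simp)).exists
  exact ⟨k * (4 * 2 ^ ℓ + 1), fun x => (survival_mul_le_pow P Y hY h' k x).trans hk⟩

end Survival

/-! ### Identification of `survival` with the exit-time law; finiteness of `halfTime`. -/

theorem coe_le_iInf_iff {p : ℕ → Prop} {t : ℕ} :
    (t : ℕ∞) ≤ ⨅ (u : ℕ) (_ : p u), (u : ℕ∞) ↔ ∀ u < t, ¬ p u := by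
  simp only [le_iInf_iff, Nat.cast_le]
  exact ⟨fun h u hu hp => absurd (h u hp) (by omega),
    fun h u hp => by by_contra hcon; exact h u (by omega) hp⟩

/-- One step of the walk together with the record of having stayed in the interval. -/
def survivalStep (ℓ : ℕ) (p : ℤ × Prop) (y : ℤ) : ℤ × Prop :=
  (p.1 + y, p.2 ∧ p.1 ∈ scaleInterval (ℓ : WithBot ℕ))

theorem chain_survivalStep {Ω : Type*} (X : ℕ → Ω → ℤ) (ℓ t : ℕ) (z : ℤ) (ω : Ω) :
    (chain (survivalStep ℓ) (z, True) (fun i => X i ω) t).1 = walk X z ω t ∧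
      ((chain (survivalStep ℓ) (z, True) (fun i => X i ω) t).2 ↔
        ∀ u < t, walk X z ω u ∈ scaleInterval (ℓ : WithBot ℕ)) := by
  induction t with
  | zero => simp [chain, walk]
  | succ t ih =>
    refine ⟨?_, ?_⟩
    · simp only [chain, survivalStep, ih.1]
      simp [walk, Finset.sum_range_succ, add_assoc]
    · simp only [chain, survivalStep, ih.1, ih.2, Nat.lt_succ_iff_lt_or_eq]
      constructor
      · rintro ⟨h1, h2⟩ u (hu | rfl)
        exacts [h1 u hu, h2]
      · exact fun h => ⟨fun u hu => h u (Or.inl hu), h t (Or.inr rfl)⟩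

open Classical in
theorem iterate_transOp_survivalStep {Ω : Type*} [MeasurableSpace Ω] (P : Measure Ω)
    [IsProbabilityMeasure P] (Y : Ω → ℤ) (ℓ t : ℕ) (z : ℤ) (p : Prop) :
    (transOp P Y (survivalStep ℓ))^[t] (fun q => if q.2 then 1 else 0) (z, p) =
      if p then survival P Y ℓ t z else 0 := by
  induction t generalizing z p with
  | zero => simp [survival]
  | succ t ih =>
    -- This form of the iterate splits off the first step of the chain, whereas `lintegral_chain`
    -- splits off the last.
    rw [Function.iterate_succ_apply', transOp]
    simp only [survivalStep, ih, survival]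
    by_cases hp : p <;> by_cases hz : z ∈ scaleInterval (ℓ : WithBot ℕ) <;> simp [hp, hz]

theorem measure_le_exitTime {Ω : Type*} [MeasurableSpace Ω] (P : Measure Ω)
    [IsProbabilityMeasure P] (X : ℕ → Ω → ℤ) (hmeas : ∀ i, Measurable (X i))
    (hindep : iIndepFun X P) (hident : ∀ i, IdentDistrib (X i) (X 0) P P) (ℓ t : ℕ) (x : ℤ) :
    P {ω | (t : ℕ∞) ≤ exitTime ℓ (walk X x ω)} = survival P (X 0) ℓ t x := by
  classical
  have h := lintegral_chain P X hmeas hindep hident (survivalStep ℓ) (x, True) t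
    (fun q => if q.2 then 1 else 0)
  rw [iterate_transOp_survivalStep, if_pos trivial] at h
  rw [← h]
  have hwalk : ∀ u, Measurable fun ω => walk X x ω u := fun u =>
    measurable_const.add (Finset.measurable_sum _ fun i _ => hmeas i)
  have hset : {ω | (t : ℕ∞) ≤ exitTime ℓ (walk X x ω)} =
      {ω | ∀ u < t, walk X x ω u ∈ scaleInterval (ℓ : WithBot ℕ)} := by
    ext ω
    simp only [exitTime, Set.mem_ofPred_eq, coe_le_iInf_iff, not_not]
  have hmset : MeasurableSet {ω | ∀ u < t, walk X x ω u ∈ scaleInterval (ℓ : WithBot ℕ)} := by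
    simp only [Set.ofPred_forall]
    exact MeasurableSet.iInter fun u => MeasurableSet.iInter fun _ =>
      hwalk u (Set.to_countable _).measurableSet
  rw [hset, ← lintegral_indicator_one hmset]
  refine lintegral_congr fun ω => ?_
  simp only [(chain_survivalStep X ℓ t x ω).2, Set.indicator_apply, Set.mem_ofPred_eq,
    Pi.one_apply]

/-- Otherwise the step is almost surely non-negative with mean at most 0, hence almost surely 0. -/
theorem prob_neg_one_ne_zero {Ω : Type*} [MeasurableSpace Ω] (P : Measure Ω)
    [IsProbabilityMeasure P] (Y : Ω → ℤ) (hlower : ∀ᵐ ω ∂P, -1 ≤ Y ω)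
    (hint : Integrable (fun ω => (Y ω : ℝ)) P) (hmean : ∫ ω, (Y ω : ℝ) ∂P ≤ 0)
    (hnondeg : P {ω | Y ω = 0} < 1) : P {ω | Y ω = -1} ≠ 0 := by
  intro h
  have h1 : ∀ᵐ ω ∂P, Y ω ≠ -1 := by simpa [ae_iff] using h
  have h2 : 0 ≤ᵐ[P] fun ω => (Y ω : ℝ) := by
    filter_upwards [hlower, h1] with ω ha hb
    have : 0 ≤ Y ω := by omega
    change (0 : ℝ) ≤ Y ω
    exact_mod_cast this
  have h3 := (integral_eq_zero_iff_of_nonneg_ae h2 hint).1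
    (le_antisymm hmean (integral_nonneg_of_ae h2))
  have h4 : P {ω | Y ω = 0} = 1 := by
    rw [← measure_univ (μ := P)]
    refine measure_congr (Filter.eventuallyEq_univ.2 ?_)
    filter_upwards [h3] with ω hω
    have : (Y ω : ℝ) = 0 := hω
    exact_mod_cast this
  exact hnondeg.ne h4

theorem exists_halfTime_eq {Ω : Type*} [MeasurableSpace Ω] (P : Measure Ω)
    [IsProbabilityMeasure P] (X : ℕ → Ω → ℤ) (hmeas : ∀ i, Measurable (X i))
    (hindep : iIndepFun X P) (hident : ∀ i, IdentDistrib (X i) (X 0) P P)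
    (hpos : P {ω | X 0 ω = -1} ≠ 0) (ℓ : ℕ) :
    ∃ n : ℕ, 0 < n ∧ halfTime P X ℓ = n ∧ ∀ x, survival P (X 0) ℓ n x ≤ 2⁻¹ := by
  have hhalf : halfTime P X ℓ = ⨅ (t : ℕ) (_ : (⨆ x ∈ scaleInterval (ℓ : WithBot ℕ),
      survival P (X 0) ℓ t x) ≤ 1 / 2), (t : ℕ∞) := by
    simp only [halfTime, measure_le_exitTime P X hmeas hindep hident]
  obtain ⟨t, ht⟩ := exists_survival_le_half P (X 0) ℓ (hmeas 0) hpos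
  have htop : halfTime P X ℓ ≤ t := by
    rw [hhalf]
    refine iInf₂_le (f := fun (u : ℕ) _ => (u : ℕ∞)) t (iSup₂_le fun x _ => ?_)
    rw [one_div]
    exact ht x
  obtain ⟨n, hn⟩ := ENat.ne_top_iff_exists.1 (ne_top_of_le_ne_top (ENat.natCast_ne_top t) htop)
  have hn' := hn.symm
  rw [hhalf] at hn'
  obtain ⟨h1, -⟩ := iInf_coe_eq_coe hn'
  rw [iSup₂_le_iff] at h1
  have hpos : 0 < n := by
    rcases Nat.eq_zero_or_pos n with rfl | h
    · have hp : (0 : ℤ) < 2 ^ ℓ := by positivity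
      have := h1 (2 ^ ℓ) ((mem_scaleInterval_iff ℓ _).2 ⟨by omega, by omega⟩)
      simp [survival] at this
    · exact h
  refine ⟨n, hpos, hn.symm, fun x => ?_⟩
  by_cases hx : x ∈ scaleInterval (ℓ : WithBot ℕ)
  · simpa using h1 x hx
  · obtain ⟨d, rfl⟩ : ∃ d, n = d + 1 := ⟨n - 1, by omega⟩
    rw [survival_of_notMem P (X 0) ℓ _ hx]; exact zero_le

/-! ### Superharmonic functions of (position, scale). -/

section Potential

variable {Ω : Type*} [MeasurableSpace Ω] (P : Measure Ω) (Y : Ω → ℤ)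

/-- The position measured in units of `2 ^ ℓ`. -/
noncomputable def relHeight (ℓ : ℕ) (x : ℤ) : ℝ≥0∞ := ENNReal.ofReal x / 2 ^ ℓ

theorem relHeight_le_iff (ℓ : ℕ) (x : ℤ) (k : ℕ) :
    relHeight ℓ x ≤ k ↔ x ≤ k * 2 ^ ℓ := by
  unfold relHeight
  rw [ENNReal.div_le_iff (by positivity) (by simp)]
  have : (k : ℝ≥0∞) * 2 ^ ℓ = ENNReal.ofReal ((k : ℝ) * 2 ^ ℓ) := by
    rw [ENNReal.ofReal_mul (by positivity), ENNReal.ofReal_pow (by norm_num)]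
    simp
  rw [this, ENNReal.ofReal_le_ofReal_iff (by positivity)]
  exact_mod_cast Iff.rfl

theorem le_relHeight (ℓ : ℕ) (x : ℤ) (k : ℕ) (h : k * 2 ^ ℓ ≤ x) : (k : ℝ≥0∞) ≤ relHeight ℓ x := by
  unfold relHeight
  rw [ENNReal.le_div_iff_mul_le (by simp) (by simp)]
  have : (k : ℝ≥0∞) * 2 ^ ℓ = ENNReal.ofReal ((k : ℝ) * 2 ^ ℓ) := by
    rw [ENNReal.ofReal_mul (by positivity), ENNReal.ofReal_pow (by norm_num)]
    simp
  rw [this]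
  refine ENNReal.ofReal_le_ofReal ?_
  exact_mod_cast h

/-- From `x > 0` a step of at least -1 cannot go below 0, so the truncation in `relHeight` loses
nothing and the mean condition applies directly. -/
theorem lintegral_relHeight_le [IsProbabilityMeasure P] (ℓ : ℕ) (hY : Measurable Y)
    (hlower : ∀ᵐ ω ∂P, -1 ≤ Y ω) (hint : Integrable (fun ω => (Y ω : ℝ)) P)
    (hmean : ∫ ω, (Y ω : ℝ) ∂P ≤ 0) {x : ℤ} (hx : 0 < x) :
    ∫⁻ ω, relHeight ℓ (x + Y ω) ∂P ≤ relHeight ℓ x := by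
  unfold relHeight
  simp only [div_eq_mul_inv]
  rw [lintegral_mul_const _ (f := fun ω => ENNReal.ofReal ((x + Y ω : ℤ) : ℝ))
    (((measurable_of_countable fun y : ℤ => ENNReal.ofReal ((x + y : ℤ) : ℝ))).comp hY)]
  gcongr
  have hint' : Integrable (fun ω => ((x + Y ω : ℤ) : ℝ)) P := by
    simpa using (integrable_const (x : ℝ)).add hint
  rw [← ofReal_integral_eq_lintegral_ofReal hint']
  · refine ENNReal.ofReal_le_ofReal ?_
    simp only [Int.cast_add]
    rw [integral_add (integrable_const _) hint]
    simpa using hmean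
  · filter_upwards [hlower] with ω hω
    have : 0 ≤ x + Y ω := by omega
    change (0 : ℝ) ≤ ((x + Y ω : ℤ) : ℝ)
    exact_mod_cast this

open Classical in
/-- An upper bound for the probability of ever being at scale `ℓ`, from position `x` and
scale `L`. -/
noncomputable def reachBound (ℓ : ℕ) (x : ℤ) (L : WithBot ℕ) : ℝ≥0∞ :=
  if L = ℓ then 1 else if L = ⊥ then 0 else min 1 (relHeight ℓ x)

theorem reachBound_self (ℓ : ℕ) (x : ℤ) : reachBound ℓ x ℓ = 1 := by simp [reachBound]

theorem reachBound_bot (ℓ : ℕ) (x : ℤ) : reachBound ℓ x ⊥ = 0 := by simp [reachBound]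

theorem reachBound_le_one (ℓ : ℕ) (x : ℤ) (L : WithBot ℕ) : reachBound ℓ x L ≤ 1 := by
  unfold reachBound
  split_ifs <;> simp

theorem reachBound_le_relHeight {ℓ : ℕ} {x : ℤ} {L : WithBot ℕ} (h : L = ℓ → level x = ℓ) :
    reachBound ℓ x L ≤ relHeight ℓ x := by
  unfold reachBound
  split_ifs with h1 h2
  · have := le_relHeight ℓ x 1 (by simpa using ((level_eq_coe_iff ℓ x).1 (h h1)).1)
    simpa using this
  · exact zero_le
  · exact min_le_right _ _

theorem lintegral_reachBound_le [IsProbabilityMeasure P] {ℓ : ℕ} (hY : Measurable Y)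
    (hlower : ∀ᵐ ω ∂P, -1 ≤ Y ω) (hint : Integrable (fun ω => (Y ω : ℝ)) P)
    (hmean : ∫ ω, (Y ω : ℝ) ∂P ≤ 0) {x : ℤ} {L : WithBot ℕ} (hL : L ≠ ℓ)
    (hx : Compatible x L) :
    ∫⁻ ω, reachBound ℓ (x + Y ω) (nextScale L (x + Y ω)) ∂P ≤ reachBound ℓ x L := by
  by_cases hbot : L = ⊥
  · subst hbot
    simp [nextScale_bot, reachBound_bot]
  · have hpos := pos_of_mem_scaleInterval (hx.resolve_left hbot)
    conv_rhs => rw [reachBound, if_neg hL, if_neg hbot]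
    refine le_min ?_ ?_
    · exact (lintegral_mono fun ω => reachBound_le_one _ _ _).trans (by simp)
    · refine le_trans (lintegral_mono fun ω => ?_)
        (lintegral_relHeight_le P Y ℓ hY hlower hint hmean hpos)
      exact reachBound_le_relHeight (level_of_nextScale_eq hL)

open Classical in
/-- A superharmonic bound for the expected total time at scale `ℓ`. -/
noncomputable def potential (ℓ n : ℕ) (x : ℤ) (L : WithBot ℕ) : ℝ≥0∞ :=
  if L = ℓ then expectedExit P Y ℓ x + n * (relHeight ℓ x + 3) else n * (7 * reachBound ℓ x L)

variable {P Y}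

/-- In the interval the height is at most 4, whence 2 + 4 + 3 = 9. -/
theorem potential_le {ℓ n : ℕ} (hW : ∀ x, expectedExit P Y ℓ x ≤ n * 2) {x : ℤ} {L : WithBot ℕ}
    (hx : Compatible x L) : potential P Y ℓ n x L ≤ n * 9 := by
  unfold potential
  split_ifs with h
  · subst h
    have hmem : x ∈ scaleInterval (ℓ : WithBot ℕ) := hx.resolve_left (by simp)
    have h4 : relHeight ℓ x ≤ (4 : ℕ) := by
      rw [relHeight_le_iff]
      exact_mod_cast ((mem_scaleInterval_iff ℓ x).1 hmem).2.le
    calc expectedExit P Y ℓ x + n * (relHeight ℓ x + 3)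
        ≤ n * 2 + n * ((4 : ℕ) + 3) := by gcongr; exact hW x
      _ = n * 9 := by rw [← mul_add]; norm_num
  · calc (n : ℝ≥0∞) * (7 * reachBound ℓ x L) ≤ n * (7 * 1) := by
          gcongr; exact reachBound_le_one _ _ _
      _ ≤ n * 9 := by gcongr; norm_num

/-- On entering scale `ℓ` the height is at most 2, whence 2 + 2 + 3 = 7. -/
theorem potential_le_of_level {ℓ n : ℕ} (hW : ∀ x, expectedExit P Y ℓ x ≤ n * 2) {x : ℤ}
    {L : WithBot ℕ} (h : L = ℓ → level x = ℓ) :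
    potential P Y ℓ n x L ≤ n * (7 * reachBound ℓ x L) := by
  by_cases hL : L = ℓ
  · have h2 : relHeight ℓ x ≤ (2 : ℕ) := by
      rw [relHeight_le_iff]
      exact_mod_cast ((level_eq_coe_iff ℓ x).1 (h hL)).2.le
    subst hL
    rw [potential, if_pos rfl, reachBound_self]
    calc expectedExit P Y ℓ x + n * (relHeight ℓ x + 3)
        ≤ n * 2 + n * ((2 : ℕ) + 3) := by gcongr; exact hW x
      _ = n * (7 * 1) := by rw [← mul_add]; norm_num
  · rw [potential, if_neg hL]

/-- The constant 3 is chosen so that the affine function $r + 3$ dominates $7\min(1, r)$ on leaving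
the interval: below, $r \le 1/2$ gives $6r \le 3$; above, $r \ge 4$ gives $7 \le r + 3$. -/
theorem potential_nextScale_le (ℓ n : ℕ) (y : ℤ) :
    potential P Y ℓ n y (nextScale ℓ y) ≤ expectedExit P Y ℓ y + n * (relHeight ℓ y + 3) := by
  by_cases hy : y ∈ scaleInterval (ℓ : WithBot ℕ)
  · rw [nextScale, if_pos hy, potential, if_pos rfl]
  · have hnext : nextScale ℓ y = level y := by simp [nextScale, hy]
    have hne : level y ≠ ℓ := by
      intro h
      have := (level_eq_coe_iff ℓ y).1 h
      exact hy ((mem_scaleInterval_iff ℓ y).2 ⟨by omega, by omega⟩)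
    rw [hnext, potential, if_neg hne, expectedExit_of_notMem P Y ℓ hy, zero_add]
    gcongr
    rw [mem_scaleInterval_iff, not_and_or, not_le, not_lt] at hy
    rcases hy with hy | hy
    · have h2 : 2 * relHeight ℓ y ≤ 1 := by
        have : 2 * relHeight ℓ y = relHeight ℓ (2 * y) := by
          unfold relHeight
          push_cast
          rw [ENNReal.ofReal_mul (by norm_num), mul_div_assoc]
          simp
        rw [this]
        have := (relHeight_le_iff ℓ (2 * y) 1).2 (by push_cast; omega)
        simpa using this
      calc 7 * reachBound ℓ y (level y) ≤ 7 * relHeight ℓ y := by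
            gcongr; exact reachBound_le_relHeight id
        _ = relHeight ℓ y + 3 * (2 * relHeight ℓ y) := by ring
        _ ≤ relHeight ℓ y + 3 * 1 := by gcongr
        _ = _ := by rw [mul_one]
    · have h4 := le_relHeight ℓ y 4 (by exact_mod_cast hy)
      calc 7 * reachBound ℓ y (level y) ≤ 7 * 1 := by
            gcongr; exact reachBound_le_one _ _ _
        _ = ((4 : ℕ) : ℝ≥0∞) + 3 := by norm_num
        _ ≤ _ := by gcongr

theorem lintegral_potential_le [IsProbabilityMeasure P] {ℓ n : ℕ} (hY : Measurable Y)
    (hlower : ∀ᵐ ω ∂P, -1 ≤ Y ω) (hint : Integrable (fun ω => (Y ω : ℝ)) P)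
    (hmean : ∫ ω, (Y ω : ℝ) ∂P ≤ 0) (hW : ∀ x, expectedExit P Y ℓ x ≤ n * 2) {x : ℤ}
    {L : WithBot ℕ} (hL : L ≠ ℓ) (hx : Compatible x L) :
    ∫⁻ ω, potential P Y ℓ n (x + Y ω) (nextScale L (x + Y ω)) ∂P ≤ potential P Y ℓ n x L := by
  calc ∫⁻ ω, potential P Y ℓ n (x + Y ω) (nextScale L (x + Y ω)) ∂P
      ≤ ∫⁻ ω, n * (7 * reachBound ℓ (x + Y ω) (nextScale L (x + Y ω))) ∂P :=
        lintegral_mono fun ω => potential_le_of_level hW (level_of_nextScale_eq hL)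
    _ = n * (7 * ∫⁻ ω, reachBound ℓ (x + Y ω) (nextScale L (x + Y ω)) ∂P) := by
        rw [lintegral_const_mul' _ _ (by simp), lintegral_const_mul' _ _ (by simp)]
    _ ≤ n * (7 * reachBound ℓ x L) := by
        gcongr; exact lintegral_reachBound_le P Y hY hlower hint hmean hL hx
    _ = potential P Y ℓ n x L := by rw [potential, if_neg hL]

theorem one_add_lintegral_potential_le [IsProbabilityMeasure P] {ℓ n : ℕ} (hY : Measurable Y)
    (hlower : ∀ᵐ ω ∂P, -1 ≤ Y ω) (hint : Integrable (fun ω => (Y ω : ℝ)) P)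
    (hmean : ∫ ω, (Y ω : ℝ) ∂P ≤ 0) {x : ℤ} (hx : Compatible x ℓ) :
    1 + ∫⁻ ω, potential P Y ℓ n (x + Y ω) (nextScale ℓ (x + Y ω)) ∂P
      ≤ potential P Y ℓ n x ℓ := by
  have hmem : x ∈ scaleInterval (ℓ : WithBot ℕ) := hx.resolve_left (by simp)
  have hpos := pos_of_mem_scaleInterval hmem
  rw [potential, if_pos rfl, expectedExit_of_mem P Y ℓ hY hmem, add_assoc]
  gcongr
  calc ∫⁻ ω, potential P Y ℓ n (x + Y ω) (nextScale ℓ (x + Y ω)) ∂P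
      ≤ ∫⁻ ω, expectedExit P Y ℓ (x + Y ω) + n * (relHeight ℓ (x + Y ω) + 3) ∂P :=
        lintegral_mono fun ω => potential_nextScale_le ℓ n _
    _ = ∫⁻ ω, expectedExit P Y ℓ (x + Y ω) ∂P
          + n * (∫⁻ ω, relHeight ℓ (x + Y ω) ∂P + 3) := by
        rw [lintegral_add_left (f := fun ω => expectedExit P Y ℓ (x + Y ω))
          ((measurable_of_countable fun y => expectedExit P Y ℓ (x + y)).comp hY),
          lintegral_const_mul' _ _ (by simp), lintegral_add_right _ measurable_const]
        simp
    _ ≤ _ := by gcongr; exact lintegral_relHeight_le P Y ℓ hY hlower hint hmean hpos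

end Potential

/-! ### Tail of the number of times at scale `ℓ`. -/

open Classical in
theorem exists_le_card_of_le_encard {A : Set ℕ} {m : ℕ} (h : (m : ℕ∞) ≤ A.encard) :
    ∃ T, m ≤ ((Finset.range T).filter fun u => u ∈ A).card := by
  obtain ⟨B, hBA, hB⟩ := Set.exists_subset_encard_eq h
  have hfin : B.Finite := Set.finite_of_encard_eq_coe hB
  obtain ⟨F, rfl⟩ := hfin.exists_finset_coe
  rw [Set.encard_coe_eq_coe_finsetCard] at hB
  have hcard : F.card = m := by exact_mod_cast hB
  refine ⟨F.sup id + 1, hcard ▸ Finset.card_le_card fun u hu => ?_⟩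
  rw [Finset.mem_filter, Finset.mem_range]
  exact ⟨Nat.lt_succ_of_le (Finset.le_sup (f := id) hu), hBA hu⟩

section Counting

open Classical in
/-- One step of the walk, its scale, and the number of times at scale `ℓ` still to be seen. -/
noncomputable def countStep (ℓ : ℕ) (p : ℤ × WithBot ℕ × ℕ) (y : ℤ) : ℤ × WithBot ℕ × ℕ :=
  (p.1 + y, nextScale p.2.1 (p.1 + y), if p.2.1 = ℓ then p.2.2 - 1 else p.2.2)

variable {Ω : Type*} [MeasurableSpace Ω]

open Classical in
/-- The probability of at least `m` times at scale `ℓ` before time `T`. -/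
noncomputable def countProb (P : Measure Ω) (Y : Ω → ℤ) (ℓ T : ℕ) (x : ℤ) (L : WithBot ℕ)
    (m : ℕ) : ℝ≥0∞ :=
  (transOp P Y (countStep ℓ))^[T] (fun p => if p.2.2 = 0 then 1 else 0) (x, L, m)

variable {P : Measure Ω} {Y : Ω → ℤ}

theorem countProb_zero_succ (ℓ : ℕ) (x : ℤ) (L : WithBot ℕ) (m : ℕ) :
    countProb P Y ℓ 0 x L (m + 1) = 0 := by
  simp [countProb]

theorem countProb_succ_self (ℓ T : ℕ) (x : ℤ) (m : ℕ) :
    countProb P Y ℓ (T + 1) x ℓ m =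
      ∫⁻ ω, countProb P Y ℓ T (x + Y ω) (nextScale ℓ (x + Y ω)) (m - 1) ∂P := by
  rw [countProb, Function.iterate_succ_apply', transOp]
  simp [countStep, countProb]

theorem countProb_succ_of_ne (ℓ T : ℕ) (x : ℤ) {L : WithBot ℕ} (hL : L ≠ ℓ) (m : ℕ) :
    countProb P Y ℓ (T + 1) x L m =
      ∫⁻ ω, countProb P Y ℓ T (x + Y ω) (nextScale L (x + Y ω)) m ∂P := by
  rw [countProb, Function.iterate_succ_apply', transOp]
  simp [countStep, countProb, hL]

variable [IsProbabilityMeasure P]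

theorem countProb_le_one (ℓ T : ℕ) (x : ℤ) (L : WithBot ℕ) (m : ℕ) :
    countProb P Y ℓ T x L m ≤ 1 := by
  induction T generalizing x L m with
  | zero =>
    simp only [countProb, Function.iterate_zero, id]
    split_ifs <;> simp
  | succ T ih =>
    by_cases hL : L = ℓ
    · subst hL
      rw [countProb_succ_self]
      exact (lintegral_mono fun ω => ih _ _ _).trans (by simp)
    · rw [countProb_succ_of_ne _ _ _ hL]
      exact (lintegral_mono fun ω => ih _ _ _).trans (by simp)

theorem countProb_of_zero (ℓ T : ℕ) (x : ℤ) (L : WithBot ℕ) : countProb P Y ℓ T x L 0 = 1 := by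
  induction T generalizing x L with
  | zero => simp [countProb]
  | succ T ih =>
    by_cases hL : L = ℓ
    · subst hL
      rw [countProb_succ_self]
      simp [ih]
    · rw [countProb_succ_of_ne _ _ _ hL]
      simp [ih]

/-- Markov's inequality by induction on the horizon, without forming the expected count. -/
theorem mul_countProb_le {ℓ n : ℕ} (hY : Measurable Y)
    (hlower : ∀ᵐ ω ∂P, -1 ≤ Y ω) (hint : Integrable (fun ω => (Y ω : ℝ)) P)
    (hmean : ∫ ω, (Y ω : ℝ) ∂P ≤ 0) (hW : ∀ x, expectedExit P Y ℓ x ≤ n * 2)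
    (T : ℕ) {x : ℤ} {L : WithBot ℕ} (hx : Compatible x L) (m : ℕ) :
    m * countProb P Y ℓ T x L m ≤ potential P Y ℓ n x L := by
  cases m with
  | zero => simp
  | succ m =>
  induction T generalizing x L m with
  | zero => simp [countProb_zero_succ]
  | succ T ih =>
    have ih' : ∀ (m : ℕ) {x : ℤ} {L : WithBot ℕ}, Compatible x L →
        m * countProb P Y ℓ T x L m ≤ potential P Y ℓ n x L := by
      intro m x L h
      cases m with
      | zero => simp
      | succ m => exact ih h m
    by_cases hL : L = ℓ
    · subst hL
      refine le_trans ?_ (one_add_lintegral_potential_le hY hlower hint hmean hx)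
      -- With `p` the probability, write `(m + 1) p = m p + p`: the visit being counted leaves `m`
      -- to see, and `p ≤ 1` is paid by the 1 in the one-step inequality.
      rw [countProb_succ_self, Nat.add_sub_cancel, Nat.cast_succ, add_mul, one_mul, add_comm,
        ← lintegral_const_mul' _ _ (by simp)]
      refine add_le_add ?_ (lintegral_mono fun ω => ih' m (compatible_nextScale _ _))
      exact (lintegral_mono fun ω => countProb_le_one _ _ _ _ _).trans (by simp)
    · refine le_trans ?_ (lintegral_potential_le hY hlower hint hmean hW hL hx)
      rw [countProb_succ_of_ne _ _ _ hL, ← lintegral_const_mul' _ _ (by simp)]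
      exact lintegral_mono fun ω => ih' (m + 1) (compatible_nextScale _ _)

/-- The strong Markov property once `m` visits have been counted. The remaining horizon is then
random, so the bound `h` is uniform in `T`. -/
theorem countProb_add_le {ℓ m' : ℕ} {G : ℝ≥0∞} (hG : G ≠ ∞)
    (h : ∀ T x L, Compatible x L → countProb P Y ℓ T x L m' ≤ G) (T : ℕ) {x : ℤ}
    {L : WithBot ℕ} (hx : Compatible x L) (m : ℕ) :
    countProb P Y ℓ T x L (m + m') ≤ countProb P Y ℓ T x L m * G := by
  induction T generalizing x L m with
  | zero =>
    cases m with
    | zero => simpa [countProb_of_zero] using h 0 x L hx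
    | succ m => rw [Nat.add_right_comm, countProb_zero_succ]; exact zero_le
  | succ T ih =>
    cases m with
    | zero => simpa [countProb_of_zero] using h (T + 1) x L hx
    | succ m =>
      by_cases hL : L = ℓ
      · subst hL
        rw [countProb_succ_self, countProb_succ_self, ← lintegral_mul_const' _ _ hG,
          Nat.add_right_comm, Nat.add_sub_cancel, Nat.add_sub_cancel]
        exact lintegral_mono fun ω => ih (compatible_nextScale _ _) m
      · rw [countProb_succ_of_ne _ _ _ hL, countProb_succ_of_ne _ _ _ hL,
          ← lintegral_mul_const' _ _ hG]
        exact lintegral_mono fun ω => ih (compatible_nextScale _ _) (m + 1)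

theorem countProb_mul_le_pow {ℓ m : ℕ} {G : ℝ≥0∞} (hG : G ≠ ∞)
    (h : ∀ T x L, Compatible x L → countProb P Y ℓ T x L m ≤ G) (k T : ℕ) {x : ℤ}
    {L : WithBot ℕ} (hx : Compatible x L) :
    countProb P Y ℓ T x L (k * m) ≤ G ^ k := by
  induction k generalizing x L with
  | zero => simp [countProb_of_zero]
  | succ k ih =>
    rw [Nat.succ_mul, pow_succ]
    exact (countProb_add_le hG h T hx (k * m)).trans (mul_le_mul' (ih hx) le_rfl)

/-- The strong Markov property at the first time at scale `ℓ`. With `m = 0` no visit would be needed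
and the factor `reachBound` would be lost. -/
theorem countProb_le_reachBound_mul {ℓ m : ℕ} {G : ℝ≥0∞} (hG : G ≠ ∞) (hm : 0 < m)
    (hY : Measurable Y) (hlower : ∀ᵐ ω ∂P, -1 ≤ Y ω)
    (hint : Integrable (fun ω => (Y ω : ℝ)) P) (hmean : ∫ ω, (Y ω : ℝ) ∂P ≤ 0)
    (h : ∀ T x L, Compatible x L → countProb P Y ℓ T x L m ≤ G) (T : ℕ) {x : ℤ}
    {L : WithBot ℕ} (hx : Compatible x L) :
    countProb P Y ℓ T x L m ≤ reachBound ℓ x L * G := by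
  induction T generalizing x L with
  | zero =>
    obtain ⟨m, rfl⟩ : ∃ d, m = d + 1 := ⟨m - 1, by omega⟩
    rw [countProb_zero_succ]; exact zero_le
  | succ T ih =>
    by_cases hL : L = ℓ
    · subst hL
      rw [reachBound_self, one_mul]
      exact h _ _ _ hx
    · rw [countProb_succ_of_ne _ _ _ hL]
      calc ∫⁻ ω, countProb P Y ℓ T (x + Y ω) (nextScale L (x + Y ω)) m ∂P
          ≤ ∫⁻ ω, reachBound ℓ (x + Y ω) (nextScale L (x + Y ω)) * G ∂P :=
            lintegral_mono fun ω => ih (compatible_nextScale _ _)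
        _ = (∫⁻ ω, reachBound ℓ (x + Y ω) (nextScale L (x + Y ω)) ∂P) * G :=
            lintegral_mul_const' _ _ hG
        _ ≤ _ := by gcongr; exact lintegral_reachBound_le P Y hY hlower hint hmean hL hx

open Classical in
theorem chain_countStep (x : ℕ → ℤ) (s : ℕ → ℤ) (hs : ∀ t, s (t + 1) = s t + x t) (ℓ m t : ℕ) :
    chain (countStep ℓ) (s 0, level (s 0), m) x t =
      (s t, scalePath s t, m - ((Finset.range t).filter fun u => scalePath s u = ℓ).card) := by
  induction t with
  | zero => simp [chain, scalePath]
  | succ t ih =>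
    rw [chain, ih, countStep]
    simp only [← hs]
    refine Prod.ext rfl (Prod.ext rfl ?_)
    simp only [Finset.range_add_one, Finset.filter_insert]
    split_ifs with h
    · rw [Finset.card_insert_of_notMem (by simp)]
      omega
    · rfl

/-- A bound for `countProb` that is uniform in the time horizon bounds the total occupation. -/
theorem measure_le_occupation_le (X : ℕ → Ω → ℤ) (hmeas : ∀ i, Measurable (X i))
    (hindep : iIndepFun X P) (hident : ∀ i, IdentDistrib (X i) (X 0) P P) {ℓ m : ℕ} {z : ℤ}
    {B : ℝ≥0∞} (hB : ∀ T, countProb P (X 0) ℓ T z (level z) m ≤ B) :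
    P {ω | (m : ℕ∞) ≤ occupation (walk X z ω) ℓ} ≤ B := by
  classical
  let E : ℕ → Set Ω := fun T =>
    {ω | m ≤ ((Finset.range T).filter fun u => scalePath (walk X z ω) u = ℓ).card}
  have hmono : Monotone E := fun S T hST ω hω =>
    le_trans hω (Finset.card_le_card (Finset.filter_subset_filter _ (Finset.range_mono hST)))
  have hsub : {ω | (m : ℕ∞) ≤ occupation (walk X z ω) ℓ} ⊆ ⋃ T, E T := by
    intro ω hω
    have h1 : (m : ℕ∞) ≤ {t | scalePath (walk X z ω) t = ℓ}.encard :=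
      le_trans hω (Set.encard_le_encard (timesAtScale_subset _ _))
    obtain ⟨T, hT⟩ := exists_le_card_of_le_encard h1
    refine Set.mem_iUnion.2 ⟨T, ?_⟩
    simpa only [E, Set.mem_ofPred_eq] using hT
  -- Continuity from below along the increasing events `E T` removes the horizon.
  refine (measure_mono hsub).trans ?_
  rw [hmono.measure_iUnion]
  refine iSup_le fun T => le_trans ?_ (hB T)
  rw [countProb, ← lintegral_chain P X hmeas hindep hident]
  have hE : ∀ ω, ω ∈ E T ↔
      (chain (countStep ℓ) (z, level z, m) (fun i => X i ω) T).2.2 = 0 := by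
    intro ω
    have h := chain_countStep (fun i => X i ω) (walk X z ω)
      (fun t => by simp [walk, Finset.sum_range_succ, add_assoc]) ℓ m T
    have h0 : walk X z ω 0 = z := by simp [walk]
    rw [h0] at h
    rw [h, Nat.sub_eq_zero_iff_le]
    exact Iff.rfl
  have hmE : MeasurableSet (E T) := by
    rw [Set.ext hE]
    exact measurableSet_chain X hmeas (countStep ℓ) (z, level z, m) T {p | p.2.2 = 0}
  rw [← lintegral_indicator_one hmE]
  refine lintegral_mono fun ω => ?_
  simp only [Set.indicator_apply, hE, Pi.one_apply, le_refl]

end Counting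

/-! ### Numerical bounds and conclusion. -/

theorem toReal_reachBound_level_le (ℓ : ℕ) (z : ℤ) :
    (reachBound ℓ z (level z)).toReal ≤
      min 1 (((max z 0 : ℤ) : ℝ) / (2 : ℝ) ^ ((ℓ : ℤ) - 1)) := by
  refine le_min ?_ ?_
  · exact ENNReal.toReal_le_of_le_ofReal zero_le_one (by simpa using reachBound_le_one ℓ z _)
  · have h : reachBound ℓ z (level z) ≤ relHeight ℓ z := reachBound_le_relHeight id
    have hne : relHeight ℓ z ≠ ∞ := ENNReal.div_ne_top ENNReal.ofReal_ne_top (by simp)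
    refine (ENNReal.toReal_mono hne h).trans ?_
    rw [relHeight, ENNReal.toReal_div, ENNReal.toReal_ofReal', ENNReal.toReal_pow,
      ENNReal.toReal_ofNat, Int.cast_max, Int.cast_zero, zpow_sub₀ two_ne_zero, zpow_natCast,
      zpow_one]
    -- The argument yields the denominator $2^\ell$; a factor 2 is given away here.
    gcongr
    have : (0 : ℝ) < 2 ^ ℓ := by positivity
    linarith

theorem half_pow_floor_le (b : ℝ) : ((2 : ℝ)⁻¹) ^ ⌊b / 18⌋₊ ≤ (2 : ℝ) ^ (1 - b / 18) := by
  rw [inv_pow, ← Real.rpow_natCast, ← Real.rpow_neg two_pos.le]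
  refine Real.rpow_le_rpow_of_exponent_le one_le_two ?_
  have := Nat.lt_floor_add_one (b / 18)
  linarith

/-- The maximum with 1 matters when `b < 18`: the floor vanishes, but `b > 0` still forces one
visit, which the factor `reachBound` requires. -/
theorem natCast_le_of_ofReal_mul_le {b : ℝ} (hb : 0 < b) {n : ℕ} (hn : 0 < n) {N : ℕ∞}
    (h : ENNReal.ofReal b * (n : ℝ≥0∞) ≤ (N : ℝ≥0∞)) :
    ((max (⌊b / 18⌋₊ * (18 * n)) 1 : ℕ) : ℕ∞) ≤ N := by
  induction N using ENat.recTopCoe with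
  | top => exact le_top
  | coe N =>
    have h1 : b * n ≤ N := by
      have h2 : ENNReal.ofReal (b * n) ≤ ENNReal.ofReal N := by
        rw [ENNReal.ofReal_mul hb.le, ENNReal.ofReal_natCast, ENNReal.ofReal_natCast]
        simpa using h
      exact (ENNReal.ofReal_le_ofReal_iff (Nat.cast_nonneg N)).1 h2
    have hn1 : (0 : ℝ) < n := by exact_mod_cast hn
    have hfl := Nat.floor_le (show 0 ≤ b / 18 by positivity)
    have h3 : max (⌊b / 18⌋₊ * (18 * n)) 1 ≤ N := by
      refine max_le ?_ ?_
      · have : ((⌊b / 18⌋₊ * (18 * n) : ℕ) : ℝ) ≤ N := by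
          push_cast
          nlinarith
        exact_mod_cast this
      · have : (0 : ℝ) < N := lt_of_lt_of_le (mul_pos hb hn1) h1
        exact_mod_cast this
    exact_mod_cast h3

/-- Here 18 is twice the 9 of `potential_le`. -/
theorem countProb_eighteen_mul_le {Ω : Type*} [MeasurableSpace Ω] {P : Measure Ω}
    [IsProbabilityMeasure P] {Y : Ω → ℤ} {ℓ n : ℕ} (hn : 0 < n) (hY : Measurable Y)
    (hlower : ∀ᵐ ω ∂P, -1 ≤ Y ω) (hint : Integrable (fun ω => (Y ω : ℝ)) P)
    (hmean : ∫ ω, (Y ω : ℝ) ∂P ≤ 0) (hW : ∀ x, expectedExit P Y ℓ x ≤ n * 2) (T : ℕ) (x : ℤ)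
    (L : WithBot ℕ) (hx : Compatible x L) : countProb P Y ℓ T x L (18 * n) ≤ 2⁻¹ := by
  have h := (mul_countProb_le hY hlower hint hmean hW T hx (18 * n)).trans (potential_le hW hx)
  have hn0 : (n : ℝ≥0∞) * 9 ≠ 0 := by simp [hn.ne']
  have hn1 : (n : ℝ≥0∞) * 9 ≠ ∞ := ENNReal.mul_ne_top (by simp) (by simp)
  rw [← ENNReal.mul_le_mul_iff_right hn0 hn1, ← ENNReal.mul_le_mul_iff_right two_ne_zero
    ENNReal.ofNat_ne_top, mul_left_comm 2 _ 2⁻¹, ENNReal.mul_inv_cancel two_ne_zero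
    ENNReal.ofNat_ne_top, mul_one]
  refine le_of_eq_of_le ?_ h
  push_cast
  ring

end ScaleWalk

theorem theorem3p7 {Ω : Type*} [MeasurableSpace Ω] (P : Measure Ω) [IsProbabilityMeasure P]
    (X : ℕ → Ω → ℤ) (hmeas : ∀ i, Measurable (X i)) (hindep : iIndepFun X P)
    (hident : ∀ i, IdentDistrib (X i) (X 0) P P)
    (hlower : ∀ᵐ ω ∂P, -1 ≤ X 0 ω)
    (hint : Integrable (fun ω => (X 0 ω : ℝ)) P) (hmean : ∫ ω, (X 0 ω : ℝ) ∂P ≤ 0)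
    (hnondeg : P {ω | X 0 ω = 0} < 1)
    (ℓ : ℕ) (b : ℝ) (hb : 0 < b) (z : ℤ) :
    P.real {ω | ENNReal.ofReal b * ((ScaleWalk.halfTime P X ℓ : ℕ∞) : ℝ≥0∞)
          / (2 : ℝ≥0∞) ^ ((ℓ : ℤ) - 1)
          ≤ ScaleWalk.harmonicOccupation (ScaleWalk.walk X z ω) ℓ}
        ≤ P.real {ω | ENNReal.ofReal b * ((ScaleWalk.halfTime P X ℓ : ℕ∞) : ℝ≥0∞)
          ≤ ((ScaleWalk.occupation (ScaleWalk.walk X z ω) ℓ : ℕ∞) : ℝ≥0∞)} ∧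
      P.real {ω | ENNReal.ofReal b * ((ScaleWalk.halfTime P X ℓ : ℕ∞) : ℝ≥0∞)
          ≤ ((ScaleWalk.occupation (ScaleWalk.walk X z ω) ℓ : ℕ∞) : ℝ≥0∞)}
        ≤ min 1 (((max z 0 : ℤ) : ℝ) / (2 : ℝ) ^ ((ℓ : ℤ) - 1)) * (2 : ℝ) ^ (1 - b / 18) := by
  obtain ⟨n, hn, hhalf, hsurv⟩ := ScaleWalk.exists_halfTime_eq P X hmeas hindep hident
    (ScaleWalk.prob_neg_one_ne_zero P (X 0) hlower hint hmean hnondeg) ℓ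
  have hW := ScaleWalk.expectedExit_le P (X 0) (hmeas 0) hn hsurv
  rw [hhalf]
  constructor
  · refine measureReal_mono (fun ω hω => ?_)
    have hc0 : (2 : ℝ≥0∞) ^ ((ℓ : ℤ) - 1) ≠ 0 :=
      (ENNReal.zpow_pos two_ne_zero ENNReal.ofNat_ne_top _).ne'
    have hc1 : (2 : ℝ≥0∞) ^ ((ℓ : ℤ) - 1) ≠ ∞ :=
      (ENNReal.zpow_lt_top two_ne_zero ENNReal.ofNat_ne_top _).ne
    have h := mul_le_mul_left (le_trans hω (ScaleWalk.harmonicOccupation_le _ ℓ))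
      ((2 : ℝ≥0∞) ^ ((ℓ : ℤ) - 1))
    rwa [ENNReal.div_mul_cancel hc0 hc1, ENNReal.div_mul_cancel hc0 hc1] at h
  · have hG : ((2 : ℝ≥0∞)⁻¹) ^ ⌊b / 18⌋₊ ≠ ∞ := ENNReal.pow_ne_top (by simp)
    have hunif : ∀ T x L, ScaleWalk.Compatible x L →
        ScaleWalk.countProb P (X 0) ℓ T x L (max (⌊b / 18⌋₊ * (18 * n)) 1)
          ≤ ((2 : ℝ≥0∞)⁻¹) ^ ⌊b / 18⌋₊ := by
      intro T x L hx
      rcases Nat.eq_zero_or_pos ⌊b / 18⌋₊ with h0 | h0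
      · rw [h0, pow_zero]
        exact ScaleWalk.countProb_le_one _ _ _ _ _
      · rw [max_eq_left (Nat.mul_pos h0 (by omega))]
        exact ScaleWalk.countProb_mul_le_pow (by simp)
          (ScaleWalk.countProb_eighteen_mul_le hn (hmeas 0) hlower hint hmean hW) _ T hx
    have hbound := ScaleWalk.measure_le_occupation_le X hmeas hindep hident fun T =>
      ScaleWalk.countProb_le_reachBound_mul hG (lt_max_of_lt_right one_pos) (hmeas 0) hlower hint
        hmean hunif T (ScaleWalk.compatible_level z)
    have hmono := (measure_mono (μ := P) fun ω hω =>
      ScaleWalk.natCast_le_of_ofReal_mul_le hb hn hω).trans hbound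
    have hfin : ScaleWalk.reachBound ℓ z (ScaleWalk.level z) * ((2 : ℝ≥0∞)⁻¹) ^ ⌊b / 18⌋₊ ≠ ∞ :=
      ENNReal.mul_ne_top (ne_top_of_le_ne_top ENNReal.one_ne_top
        (ScaleWalk.reachBound_le_one _ _ _)) hG
    refine (ENNReal.toReal_mono hfin hmono).trans ?_
    rw [ENNReal.toReal_mul, ENNReal.toReal_pow, ENNReal.toReal_inv, ENNReal.toReal_ofNat]
    exact mul_le_mul (ScaleWalk.toReal_reachBound_level_le ℓ z) (ScaleWalk.half_pow_floor_le b)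
      (by positivity) (le_min zero_le_one (by positivity))
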